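/- Let $\frac13\le\beta\le\frac12$, and let $\log$ denote the logarithm with base $2$. Let $\mathbb C^4=\mathbb C^2\otimes\mathbb C^2$ have the orthonormal basis $|m_0\rangle=|00\rangle$, $|m_1\rangle=|01\rangle$, $|m_2\rangle=|10\rangle$, $|m_3\rangle=|11\rangle$. For a key $b=(u,w)\in\{0,1\}^2$ let $$v=v(b)=\tfrac1{\sqrt3}\big((-1)^u,(-1)^{u+w},(-1)^w\big)=(v_x,v_y,v_z)$$ (the direction on the Bloch sphere of the 8-state encoding of the bit $0$ in the basis $b$), and let $$|E^{v}_{01}\rangle=\frac1{\sqrt{1-\beta}}\Big[\sqrt{1-\tfrac32\beta}\,|m_0\rangle+\sqrt{\tfrac\beta2}\,\big(v_x|m_1\rangle+v_y|m_2\rangle+v_z|m_3\rangle\big)\Big],$$ $$|E^{v}_{00}\rangle=\frac1{\sqrt{2(1-v_z^2)}}\Big[(-v_xv_z-iv_y)|m_1\rangle+(-v_yv_z+iv_x)|m_2\rangle+(1-v_z^2)|m_3\rangle\Big],$$ $$\zeta_b=(1-\beta)\,|E^{v(b)}_{01}\rangle\langle E^{v(b)}_{01}|+\beta\,|E^{v(b)}_{00}\rangle\langle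 E^{v(b)}_{00}|$$ (Eve's ancilla state in the attack that couples each qubit to an ancilla and causes the bit error rate $\beta$, given that Alice's outcome is $0$). Let $B=(U,W)$ be uniformly distributed on $\{0,1\}^2$. For a POVM $\mathcal M=(M_m)_m$ on $\mathbb C^4$ with finitely many outcomes, let $H(B|\mathcal M(\zeta_B))$ be the Shannon entropy in bits of $B$ given the outcome of $\mathcal M$ applied to $\zeta_B$, that is, for the joint distribution $\Pr[B=b,\,\mathcal M(\zeta_B)=m]=\frac14\operatorname{tr}(M_m\zeta_b)$. Define $$|a'\rangle=-\frac{\sqrt{\beta/2}}{\sqrt{1-\beta}}\,|m_0\rangle+\frac{\sqrt{1-\frac32\beta}}{\sqrt{1-\beta}}\cdot\frac{|m_1\rangle+|m_2\rangle+|m_3\rangle}{\sqrt3},$$ $$|d\rangle=\frac{e^{i\pi/3}|m_1\rangle+e^{-i\pi/3}|m_2\rangle-|m_3\rangle}{\sqrt3},\qquad |d'\rangle=|d\rangle^*,$$ where $^*$ is entrywise complex conjugation, and $$R_{00}=\frac{1-\beta}{2\beta}|a'\rangle\langle a'|+\frac{3\beta-1}{2\beta}|d'\rangle\langle d'|,\qquad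 R_{01}=(\sigma_z\otimes\mathbb 1)R_{00}(\sigma_z\otimes\mathbb 1),$$ $$R_{10}=(\sigma_z\otimes\sigma_z)R_{00}(\sigma_z\otimes\sigma_z),\qquad R_{11}=(\mathbb 1\otimes\sigma_z)R_{00}(\mathbb 1\otimes\sigma_z).$$ Then $\mathcal R=(R_{uw})_{u,w\in\{0,1\}}$ is a POVM, $H(B|\mathcal R(\zeta_B))=\log 3$, and $\mathcal R$ is optimal in terms of Shannon entropy: $H(B|\mathcal R(\zeta_B))\le H(B|\mathcal M(\zeta_B))$ for every POVM $\mathcal M$ on $\mathbb C^4$ with finitely many outcomes. -/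

import Mathlib

/-! Attack K2 on 8-state encoding: Eve's ancilla states, POVMs, and the Shannon entropy of the
basis key given the outcome of a measurement. Eve's space is `ℂ⁴` with orthonormal basis
`m₀, m₁, m₂, m₃`, the coordinates of `Fin 4 → ℂ`. -/

open scoped Kronecker ComplexOrder

noncomputable section

namespace EightState

/-- The rank-one operator `|ψ⟩⟨ψ|`. -/
def proj (ψ : Fin 4 → ℂ) : Matrix (Fin 4) (Fin 4) ℂ := Matrix.vecMulVec ψ (star ψ)

/-- The basis key `b = (u, w)`, with `u, w ∈ {0, 1}`. -/
abbrev Key : Type := Fin 2 × Fin 2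

/-- The direction on the Bloch sphere of the encoding of the bit `0` in the basis `(u, w)`. -/
def bloch (b : Key) : Fin 3 → ℝ :=
  ![(-1) ^ (b.1 : ℕ) / √3, (-1) ^ ((b.1 : ℕ) + (b.2 : ℕ)) / √3, (-1) ^ (b.2 : ℕ) / √3]

/-- Eve's state `|E₀₁^v⟩` for the outcomes `x = 0`, `y = 1` of Alice and Bob, when they measure
their spins in the direction `v` and the bit error rate is `β`. -/
def ketE01 (β : ℝ) (v : Fin 3 → ℝ) : Fin 4 → ℂ :=
  ((1 / √(1 - β) : ℝ) : ℂ) •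
    ![((√(1 - 3 / 2 * β) : ℝ) : ℂ), ((√(β / 2) * v 0 : ℝ) : ℂ),
      ((√(β / 2) * v 1 : ℝ) : ℂ), ((√(β / 2) * v 2 : ℝ) : ℂ)]

/-- Eve's state `|E₀₀^v⟩` for the outcomes `x = 0`, `y = 0`. -/
def ketE00 (v : Fin 3 → ℝ) : Fin 4 → ℂ :=
  ((1 / √(2 * (1 - v 2 ^ 2)) : ℝ) : ℂ) •
    ![0, -(v 0 : ℂ) * (v 2 : ℂ) - Complex.I * (v 1 : ℂ),
      -(v 1 : ℂ) * (v 2 : ℂ) + Complex.I * (v 0 : ℂ), 1 - (v 2 : ℂ) ^ 2]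

/-- Eve's mixed state `ζ_b` for the basis key `b`, given `x = 0`. -/
def zeta (β : ℝ) (b : Key) : Matrix (Fin 4) (Fin 4) ℂ :=
  ((1 - β : ℝ) : ℂ) • proj (ketE01 β (bloch b)) + (β : ℂ) • proj (ketE00 (bloch b))

/-- A positive operator valued measure on `ℂ⁴` with outcomes in the finite type `ι`. -/
def IsPOVM {ι : Type*} [Fintype ι] (M : ι → Matrix (Fin 4) (Fin 4) ℂ) : Prop :=
  (∀ m, (M m).PosSemidef) ∧ ∑ m, M m = 1

/-- The probability `tr (M_m ρ)` of the outcome belonging to the operator `A = M_m`. -/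
def outcomeProb (A ρ : Matrix (Fin 4) (Fin 4) ℂ) : ℝ := (A * ρ).trace.re

/-- The Shannon entropy in bits, `∑ p log (1/p)` (with `0 log (1/0) = 0`). -/
def shannon {α : Type*} [Fintype α] (p : α → ℝ) : ℝ := ∑ a, p a * Real.logb 2 (1 / p a)

/-- The Shannon entropy `H(B | M(ρ_B))` of a uniformly distributed key `B`, given the outcome of the
measurement `M` on `ρ_B`, that is `∑ₘ Pr[m] H(B | m)`, where `Pr[b | m] = Pr[b, m] / Pr[m]`. -/
def entropyGiven {ι : Type*} [Fintype ι] (M : ι → Matrix (Fin 4) (Fin 4) ℂ)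
    (ρ : Key → Matrix (Fin 4) (Fin 4) ℂ) : ℝ :=
  ∑ m, (∑ b, 1 / 4 * outcomeProb (M m) (ρ b)) *
    shannon fun b => 1 / 4 * outcomeProb (M m) (ρ b) / ∑ b', 1 / 4 * outcomeProb (M m) (ρ b')

/-- The Pauli matrix `σ_z`. -/
def sigmaZ : Matrix (Fin 2) (Fin 2) ℂ := !![1, 0; 0, -1]

/-- `A ⊗ B` as an operator on `ℂ⁴`, where `m₀, m₁, m₂, m₃` are `|00⟩, |01⟩, |10⟩, |11⟩`. -/
def tensor (A B : Matrix (Fin 2) (Fin 2) ℂ) : Matrix (Fin 4) (Fin 4) ℂ :=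
  Matrix.reindex finProdFinEquiv finProdFinEquiv (A ⊗ₖ B)

/-- The symmetry of the ensemble that carries the key `(0, 0)` to the key `(u, w)`. -/
def symm (b : Key) : Matrix (Fin 4) (Fin 4) ℂ :=
  !![tensor 1 1, tensor sigmaZ 1; tensor sigmaZ sigmaZ, tensor 1 sigmaZ] b.1 b.2

/-- The vector `|a'⟩`. -/
def ketA' (β : ℝ) : Fin 4 → ℂ :=
  ![((-(√(β / 2) / √(1 - β)) : ℝ) : ℂ), ((√(1 - 3 / 2 * β) / √(1 - β) / √3 : ℝ) : ℂ),
    ((√(1 - 3 / 2 * β) / √(1 - β) / √3 : ℝ) : ℂ), ((√(1 - 3 / 2 * β) / √(1 - β) / √3 : ℝ) : ℂ)]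

/-- The vector `|d⟩`. -/
def ketD : Fin 4 → ℂ :=
  ((1 / √3 : ℝ) : ℂ) •
    ![0, Complex.exp (Complex.I * Real.pi / 3), Complex.exp (-(Complex.I * Real.pi / 3)), -1]

/-- The vector `|d'⟩`, the entrywise complex conjugate of `|d⟩`. -/
def ketD' : Fin 4 → ℂ := star ketD

/-- The operator `R₀₀`. -/
def R00 (β : ℝ) : Matrix (Fin 4) (Fin 4) ℂ :=
  (((1 - β) / (2 * β) : ℝ) : ℂ) • proj (ketA' β) + (((3 * β - 1) / (2 * β) : ℝ) : ℂ) • proj ketD'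

/-- The POVM `R = (R_{uw})`. -/
def R (β : ℝ) (b : Key) : Matrix (Fin 4) (Fin 4) ℂ := symm b * R00 β * symm b

end EightState

end

open scoped Kronecker ComplexOrder

namespace EightState

/-! Each `zeta β b` is affine in the Bloch direction `v(b)`, so a positive operator `M` has outcome
probabilities `A + v(b) ⬝ g`, and for every such `M` one finds `‖g‖ ≤ A`. The four directions form a
regular tetrahedron: they sum to zero and `∑ (v ⬝ g)² = (4/3) ‖g‖²`. Hence `∑ p² = 4A² + (4/3)‖g‖² ≤
(∑ p)² / 3`: given any outcome, the collision probability of the key is at most `1/3`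
(`three_mul_sum_sq_le`). Shannon entropy dominates collision entropy, so it is at least `log 3`
outcome by outcome (`logb_three_le_shannon`). The measurement `R` attains this bound: outcome `b`
excludes the key `b` and leaves the other three equally likely (`outcomeProb_R`). -/

theorem proj_apply (ψ : Fin 4 → ℂ) (i j : Fin 4) : proj ψ i j = ψ i * star (ψ j) := rfl

theorem proj_posSemidef (ψ : Fin 4 → ℂ) : (proj ψ).PosSemidef :=
  Matrix.posSemidef_vecMulVec_self_star ψ

theorem zeta_posSemidef {β : ℝ} (h0 : 0 ≤ β) (h1 : β ≤ 1) (b : Key) : (zeta β b).PosSemidef := by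
  refine ((proj_posSemidef _).smul ?_).add ((proj_posSemidef _).smul ?_)
  · exact Complex.zero_le_real.2 (by linarith)
  · exact Complex.zero_le_real.2 h0

theorem outcomeProb_proj (ψ : Fin 4 → ℂ) (ρ : Matrix (Fin 4) (Fin 4) ℂ) :
    outcomeProb (proj ψ) ρ = (star ψ ⬝ᵥ ρ.mulVec ψ).re := by
  rw [outcomeProb, Matrix.trace_mul_comm, proj, Matrix.mul_vecMulVec, Matrix.trace_vecMulVec,
    dotProduct_comm]

theorem outcomeProb_sum {κ : Type*} (s : Finset κ) (A : κ → Matrix (Fin 4) (Fin 4) ℂ)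
    (ρ : Matrix (Fin 4) (Fin 4) ℂ) :
    outcomeProb (∑ k ∈ s, A k) ρ = ∑ k ∈ s, outcomeProb (A k) ρ := by
  simp [outcomeProb, Finset.sum_mul, Matrix.trace_sum]

theorem exists_eq_sum_proj {M : Matrix (Fin 4) (Fin 4) ℂ} (hM : M.PosSemidef) :
    ∃ ψ : Fin 4 → Fin 4 → ℂ, M = ∑ k, proj (ψ k) := by
  obtain ⟨B, rfl⟩ := (by
    open scoped MatrixOrder in exact CStarAlgebra.nonneg_iff_eq_star_mul_self.mp hM.nonneg :
      ∃ B : Matrix (Fin 4) (Fin 4) ℂ, M = star B * B)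
  refine ⟨fun k => star (B k), ?_⟩
  ext i j
  simp [Matrix.mul_apply, Matrix.sum_apply, proj, Matrix.vecMulVec_apply]

/-! ### The states as affine functions of the Bloch direction -/

/-- The matrix `s² ⊕ t² (1 + i [v]ₓ)` with the off-diagonal blocks `s t v`. -/
def blochMatrix (s t : ℝ) (v : Fin 3 → ℝ) : Matrix (Fin 4) (Fin 4) ℂ :=
  !![(s : ℂ) ^ 2, s * t * v 0, s * t * v 1, s * t * v 2;
     s * t * v 0, t ^ 2, Complex.I * t ^ 2 * v 2, -(Complex.I * t ^ 2 * v 1);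
     s * t * v 1, -(Complex.I * t ^ 2 * v 2), t ^ 2, Complex.I * t ^ 2 * v 0;
     s * t * v 2, Complex.I * t ^ 2 * v 1, -(Complex.I * t ^ 2 * v 0), t ^ 2]

/-- On `m₁, m₂, m₃` the first term gives `t² v vᵀ` and the second `t² (1 - v vᵀ + i [v]ₓ)`; the
quadratic parts cancel, which leaves a matrix affine in `v`. -/
theorem ketMixture_eq_blochMatrix {β : ℝ} (h0 : 0 ≤ β) (h1 : β ≤ 1 / 2) {v : Fin 3 → ℝ}
    (hv : v 0 ^ 2 + v 1 ^ 2 + v 2 ^ 2 = 1) (hz : v 2 ^ 2 < 1) :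
    ((1 - β : ℝ) : ℂ) • proj (ketE01 β v) + (β : ℂ) • proj (ketE00 v) =
      blochMatrix (√(1 - 3 / 2 * β)) (√(β / 2)) v := by
  have hs : √(1 - 3 / 2 * β) ^ 2 = 1 - 3 / 2 * β := Real.sq_sqrt (by linarith)
  have ht : √(β / 2) ^ 2 = β / 2 := Real.sq_sqrt (by linarith)
  have hn : (1 / √(1 - β)) ^ 2 * (1 - β) = 1 := by
    rw [div_pow, Real.sq_sqrt (by linarith)]; field_simp [show 1 - β ≠ 0 by linarith]
  have hc : (1 / √(2 * (1 - v 2 ^ 2))) ^ 2 * (2 * (1 - v 2 ^ 2)) = 1 := by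
    rw [div_pow, Real.sq_sqrt (by linarith)]
    field_simp [show 1 - v 2 ^ 2 ≠ 0 by linarith]
  simp only [ketE01, ketE00, blochMatrix]
  generalize √(1 - 3 / 2 * β) = s at *
  generalize √(β / 2) = t at *
  generalize 1 / √(1 - β) = n at *
  generalize 1 / √(2 * (1 - v 2 ^ 2)) = c at *
  generalize v 0 = x at *
  generalize v 1 = y at *
  generalize v 2 = z at *
  ext i j
  simp only [Matrix.add_apply, Matrix.smul_apply, proj_apply, Pi.smul_apply]
  fin_cases i <;> fin_cases j <;>
    simp [Complex.ext_iff, pow_two] <;> (try constructor) <;> grind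

theorem inv_sqrt_three_sq : (√3)⁻¹ ^ 2 = 1 / 3 := by
  rw [inv_pow, Real.sq_sqrt (by norm_num)]; norm_num

theorem zeta_eq_blochMatrix {β : ℝ} (h0 : 0 ≤ β) (h1 : β ≤ 1 / 2) (b : Key) :
    zeta β b = blochMatrix (√(1 - 3 / 2 * β)) (√(β / 2)) (bloch b) := by
  have h3 := inv_sqrt_three_sq
  have h : ∀ i, bloch b i ^ 2 = 1 / 3 := by
    intro i
    fin_cases i <;> simp [bloch, div_eq_mul_inv, mul_pow, ← pow_mul, mul_comm _ 2]
  apply ketMixture_eq_blochMatrix h0 h1 <;> norm_num [h]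

theorem exists_outcomeProb_proj_blochMatrix (s t : ℝ) (ψ : Fin 4 → ℂ) :
    ∃ (A : ℝ) (g : EuclideanSpace ℝ (Fin 3)), ‖g‖ ≤ A ∧
      ∀ v, outcomeProb (proj ψ) (blochMatrix s t v) = A + ∑ i, v i * g i := by
  refine ⟨s ^ 2 * Complex.normSq (ψ 0) + t ^ 2 * (Complex.normSq (ψ 1) + Complex.normSq (ψ 2) +
    Complex.normSq (ψ 3)), !₂[
      2 * s * t * (star (ψ 0) * ψ 1).re - 2 * t ^ 2 * (star (ψ 2) * ψ 3).im,
      2 * s * t * (star (ψ 0) * ψ 2).re - 2 * t ^ 2 * (star (ψ 3) * ψ 1).im,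
      2 * s * t * (star (ψ 0) * ψ 3).re - 2 * t ^ 2 * (star (ψ 1) * ψ 2).im], ?_, fun v => ?_⟩
  · refine (sq_le_sq₀ (norm_nonneg _) ?_).1 ?_
    · have h := fun i => Complex.normSq_nonneg (ψ i)
      exact add_nonneg (mul_nonneg (sq_nonneg s) (h 0))
        (mul_nonneg (sq_nonneg t) (add_nonneg (add_nonneg (h 1) (h 2)) (h 3)))
    · rw [EuclideanSpace.real_norm_sq_eq, ← sub_nonneg]
      -- `A² - ‖g‖²` is the squared modulus of `s² ψ₀² - t² (ψ₁² + ψ₂² + ψ₃²)`.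
      refine (add_nonneg
        (sq_nonneg (s ^ 2 * (ψ 0 ^ 2).re - t ^ 2 * (ψ 1 ^ 2 + ψ 2 ^ 2 + ψ 3 ^ 2).re))
        (sq_nonneg (s ^ 2 * (ψ 0 ^ 2).im - t ^ 2 * (ψ 1 ^ 2 + ψ 2 ^ 2 + ψ 3 ^ 2).im))).trans_eq ?_
      simp [Fin.sum_univ_succ, Complex.normSq_apply, pow_two (ψ _)]
      ring
  · rw [outcomeProb_proj]
    simp [blochMatrix, dotProduct, Matrix.mulVec, Fin.sum_univ_succ, Complex.normSq_apply, pow_two]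
    ring

/-- The pairs with `‖g‖ ≤ A` form a convex cone, so the rank-one case suffices. -/
theorem exists_outcomeProb_blochMatrix (s t : ℝ) {M : Matrix (Fin 4) (Fin 4) ℂ}
    (hM : M.PosSemidef) :
    ∃ (A : ℝ) (g : EuclideanSpace ℝ (Fin 3)), ‖g‖ ≤ A ∧
      ∀ v, outcomeProb M (blochMatrix s t v) = A + ∑ i, v i * g i := by
  obtain ⟨ψ, rfl⟩ := exists_eq_sum_proj hM
  choose A g hg h using fun k => exists_outcomeProb_proj_blochMatrix s t (ψ k)
  refine ⟨∑ k, A k, ∑ k, g k, (norm_sum_le _ _).trans (Finset.sum_le_sum fun k _ => hg k),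
    fun v => ?_⟩
  simp only [outcomeProb_sum, h, Finset.sum_add_distrib, WithLp.ofLp_sum, Finset.sum_apply,
    Finset.mul_sum]
  rw [Finset.sum_comm]

theorem three_mul_sum_sq_le {β : ℝ} (h0 : 0 ≤ β) (h1 : β ≤ 1 / 2)
    {M : Matrix (Fin 4) (Fin 4) ℂ} (hM : M.PosSemidef) :
    3 * ∑ b, outcomeProb M (zeta β b) ^ 2 ≤ (∑ b, outcomeProb M (zeta β b)) ^ 2 := by
  obtain ⟨A, g, hg, h⟩ := exists_outcomeProb_blochMatrix (√(1 - 3 / 2 * β)) (√(β / 2)) hM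
  have hA := pow_le_pow_left₀ (norm_nonneg g) hg 2
  have h3 := inv_sqrt_three_sq
  simp only [zeta_eq_blochMatrix h0 h1, h]
  rw [EuclideanSpace.real_norm_sq_eq] at hA
  simp [Fintype.sum_prod_type, Fin.sum_univ_succ, bloch, div_eq_mul_inv] at hA ⊢
  generalize (√3)⁻¹ = r at *
  -- The cross terms in `g` cancel by the tetrahedral symmetry of the four directions.
  linear_combination 4 * hA + 12 * (g 0 ^ 2 + g 1 ^ 2 + g 2 ^ 2) * h3

/-! ### The entropy lower bound -/

theorem outcomeProb_nonneg {M ρ : Matrix (Fin 4) (Fin 4) ℂ} (hM : M.PosSemidef)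
    (hρ : ρ.PosSemidef) : 0 ≤ outcomeProb M ρ := by
  obtain ⟨ψ, rfl⟩ := exists_eq_sum_proj hM
  rw [outcomeProb_sum]
  refine Finset.sum_nonneg fun k _ => ?_
  rw [outcomeProb_proj]
  exact hρ.re_dotProduct_nonneg (ψ k)

theorem trace_zeta {β : ℝ} (h0 : 0 ≤ β) (h1 : β ≤ 1 / 2) (b : Key) : (zeta β b).trace = 1 := by
  have hs : √(1 - 3 / 2 * β) ^ 2 = 1 - 3 / 2 * β := Real.sq_sqrt (by linarith)
  have ht : √(β / 2) ^ 2 = β / 2 := Real.sq_sqrt (by linarith)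
  rw [zeta_eq_blochMatrix h0 h1]
  simp only [blochMatrix, Matrix.trace, Fin.sum_univ_four]
  generalize √(1 - 3 / 2 * β) = s at *
  generalize √(β / 2) = t at *
  simp [← Complex.ofReal_pow, hs, ht]
  ring

theorem sum_prob_eq_one {β : ℝ} (h0 : 0 ≤ β) (h1 : β ≤ 1 / 2) {ι : Type*} [Fintype ι]
    {M : ι → Matrix (Fin 4) (Fin 4) ℂ} (hM : IsPOVM M) :
    ∑ m, ∑ b, 1 / 4 * outcomeProb (M m) (zeta β b) = 1 := by
  rw [Finset.sum_comm]
  simp_rw [← Finset.mul_sum, ← outcomeProb_sum, hM.2]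
  simp [outcomeProb, trace_zeta h0 h1]

theorem logb_three_le_shannon {α : Type*} [Fintype α] {q : α → ℝ} (hq : ∀ a, 0 ≤ q a)
    (h1 : ∑ a, q a = 1) (h2 : 3 * ∑ a, q a ^ 2 ≤ 1) : Real.logb 2 3 ≤ shannon q := by
  have hlog : 0 < Real.log 2 := Real.log_pos (by norm_num)
  -- Tangent line to the logarithm at `3 q = 1`; equality holds for `q = 0` and `q = 1/3`, the
  -- values that `R` produces.
  have key : ∀ a, q a * (Real.log 3 + 1 - 3 * q a) ≤ q a * Real.log (1 / q a) := by
    intro a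
    rcases (hq a).eq_or_lt with h | h
    · simp [← h]
    · refine mul_le_mul_of_nonneg_left ?_ h.le
      have := Real.log_le_sub_one_of_pos (by positivity : 0 < 3 * q a)
      rw [Real.log_mul (by norm_num) h.ne'] at this
      rw [one_div, Real.log_inv]
      linarith
  have hsum := Finset.sum_le_sum fun a (_ : a ∈ Finset.univ) => key a
  have hl : ∑ a, q a * (Real.log 3 + 1 - 3 * q a) = Real.log 3 + 1 - 3 * ∑ a, q a ^ 2 := by
    simp_rw [show ∀ a, q a * (Real.log 3 + 1 - 3 * q a) =
      q a * (Real.log 3 + 1) - 3 * q a ^ 2 from fun a => by ring]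
    rw [Finset.sum_sub_distrib, ← Finset.sum_mul, h1, ← Finset.mul_sum, one_mul]
  simp only [shannon, Real.logb, ← mul_div_assoc, ← Finset.sum_div]
  gcongr
  linarith

theorem logb_three_le_entropyGiven {β : ℝ} (h0 : 0 ≤ β) (h1 : β ≤ 1 / 2) {ι : Type*} [Fintype ι]
    {M : ι → Matrix (Fin 4) (Fin 4) ℂ} (hM : IsPOVM M) :
    Real.logb 2 3 ≤ entropyGiven M (zeta β) := by
  rw [← one_mul (Real.logb 2 3), ← sum_prob_eq_one h0 h1 hM, Finset.sum_mul, entropyGiven]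
  refine Finset.sum_le_sum fun m _ => ?_
  have hp : ∀ b, 0 ≤ outcomeProb (M m) (zeta β b) := fun b =>
    outcomeProb_nonneg (hM.1 m) (zeta_posSemidef h0 (by linarith) b)
  have h3 := three_mul_sum_sq_le h0 h1 (hM.1 m)
  rw [← Finset.mul_sum]
  have hS : 0 ≤ ∑ b, outcomeProb (M m) (zeta β b) := Finset.sum_nonneg fun b _ => hp b
  obtain ⟨p, hpdef⟩ : ∃ p : Key → ℝ, ∀ b, outcomeProb (M m) (zeta β b) = p b := ⟨_, fun _ => rfl⟩
  simp only [hpdef] at hp h3 hS ⊢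
  rcases hS.eq_or_lt with h | h
  -- An outcome of probability zero contributes zero.
  · simp [← h]
  · refine mul_le_mul_of_nonneg_left (logb_three_le_shannon (fun b => ?_) ?_ ?_) (by positivity)
    · have := hp b
      positivity
    · rw [← Finset.sum_div, ← Finset.mul_sum, div_self (by positivity)]
    · simp_rw [div_pow, mul_pow]
      rw [← Finset.sum_div, ← Finset.mul_sum, ← mul_div_assoc, div_le_one (by positivity)]
      linarith

/-! ### The optimal measurement -/

/-- The diagonal of the matrix `symm b`. -/
def sign (b : Key) : Fin 4 → ℂ :=
  ![1, (-1) ^ (b.1 : ℕ), (-1) ^ ((b.1 : ℕ) + (b.2 : ℕ)), (-1) ^ (b.2 : ℕ)]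

theorem symm_eq_diagonal (b : Key) : symm b = Matrix.diagonal (sign b) := by
  obtain ⟨u, w⟩ := b
  ext i j
  fin_cases u <;> fin_cases w <;> fin_cases i <;> fin_cases j <;>
    simp [symm, tensor, sigmaZ, sign, finProdFinEquiv, Fin.divNat, Fin.modNat]

theorem R_posSemidef {β : ℝ} (h0 : 1 / 3 ≤ β) (h1 : β ≤ 1 / 2) (b : Key) :
    (R β b).PosSemidef := by
  have hR : (R00 β).PosSemidef := by
    refine ((proj_posSemidef _).smul ?_).add ((proj_posSemidef _).smul ?_)
    · exact Complex.zero_le_real.2 (div_nonneg (by linarith) (by linarith))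
    -- The weight `(3β - 1) / (2β)` is where `1/3 ≤ β` matters.
    · exact Complex.zero_le_real.2 (div_nonneg (by linarith) (by linarith))
  have hs : (symm b).conjTranspose = symm b := by
    rw [symm_eq_diagonal, Matrix.diagonal_conjTranspose]
    congr 1
    ext i
    fin_cases i <;> simp [sign]
  simpa only [hs, R] using hR.conjTranspose_mul_mul_same (symm b)

theorem ketD_eq : ketD = ((1 / √3 : ℝ) : ℂ) •
    ![0, 1 / 2 + (√3 / 2 : ℝ) * Complex.I, 1 / 2 - (√3 / 2 : ℝ) * Complex.I, -1] := by
  have h : Complex.I * Real.pi / 3 = ((Real.pi / 3 : ℝ) : ℂ) * Complex.I := by push_cast; ring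
  rw [ketD, h, ← neg_mul, ← Complex.ofReal_neg, Complex.exp_mul_I, Complex.exp_mul_I]
  simp only [← Complex.ofReal_cos, ← Complex.ofReal_sin, Real.cos_neg, Real.sin_neg,
    Real.cos_pi_div_three, Real.sin_pi_div_three]
  norm_num [sub_eq_add_neg]

theorem R00_eq {β : ℝ} (h0 : 1 / 3 ≤ β) (h1 : β ≤ 1 / 2) {u p q : ℝ}
    (hu : u = √(1 - 3 / 2 * β) * √(β / 2) / (2 * √3 * β)) (hp : p = (1 - 2 * β) / (4 * β))
    (hq : q = √3 * (3 * β - 1) / (12 * β)) :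
    R00 β = !![1 / 4, -(u : ℂ), -(u : ℂ), -(u : ℂ);
      -(u : ℂ), 1 / 4, p - q * Complex.I, p + q * Complex.I;
      -(u : ℂ), p + q * Complex.I, 1 / 4, p - q * Complex.I;
      -(u : ℂ), p - q * Complex.I, p + q * Complex.I, 1 / 4] := by
  have hs : √(1 - 3 / 2 * β) ^ 2 = 1 - 3 / 2 * β := Real.sq_sqrt (by linarith)
  have ht : √(β / 2) ^ 2 = β / 2 := Real.sq_sqrt (by linarith)
  have hn : √(1 - β) ^ 2 = 1 - β := Real.sq_sqrt (by linarith)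
  have h3 : √3 ^ 2 = 3 := Real.sq_sqrt (by norm_num)
  have hn0 : √(1 - β) ≠ 0 := (Real.sqrt_pos.2 (by linarith)).ne'
  have h30 : √3 ≠ 0 := (Real.sqrt_pos.2 (by norm_num)).ne'
  have hb0 : β ≠ 0 := by linarith
  simp only [R00, ketA', ketD', ketD_eq]
  obtain ⟨k, hk⟩ : ∃ k, k = (1 - β) / (2 * β) := ⟨_, rfl⟩
  obtain ⟨l, hl⟩ : ∃ l, l = (3 * β - 1) / (2 * β) := ⟨_, rfl⟩
  obtain ⟨x, hx⟩ : ∃ x, x = √(β / 2) / √(1 - β) := ⟨_, rfl⟩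
  obtain ⟨y, hy⟩ : ∃ y, y = √(1 - 3 / 2 * β) / √(1 - β) / √3 := ⟨_, rfl⟩
  obtain ⟨c, hc⟩ : ∃ c, c = 1 / √3 := ⟨_, rfl⟩
  obtain ⟨d, hd⟩ : ∃ d, d = √3 / 2 := ⟨_, rfl⟩
  rw [← hk, ← hl, ← hx, ← hy, ← hc, ← hd]
  have hn1 : 1 - β ≠ 0 := by linarith
  have e0 : k * x ^ 2 = 1 / 4 := by
    rw [hk, hx, div_pow, hn, ht]; field_simp; norm_num
  have e1 : k * (x * y) = u := by
    rw [hk, hx, hy, hu, show ∀ a b c d : ℝ, a / b * (c / b / d) = a * c / (b ^ 2 * d) from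
      fun a b c d => by rw [div_div, div_mul_div_comm]; ring, hn]
    field_simp
  have e2 : k * y ^ 2 = (2 - 3 * β) / (12 * β) := by
    rw [hk, hy, div_pow, div_pow, hn, hs, h3]; field_simp; ring
  have e3 : l * c ^ 2 = (3 * β - 1) / (6 * β) := by
    rw [hl, hc, div_pow, h3]; field_simp; ring
  have e4 : k * y ^ 2 + l * c ^ 2 = 1 / 4 := by
    rw [e2, e3]; field_simp; ring
  have e5 : k * y ^ 2 - l * c ^ 2 / 2 = p := by
    rw [e2, e3, hp]; field_simp; ring
  have e6 : l * c ^ 2 * d = q := by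
    rw [e3, hd, hq]; field_simp; ring
  have e7 : d ^ 2 = 3 / 4 := by rw [hd, div_pow, h3]; norm_num
  clear * - e0 e1 e4 e5 e6 e7
  ext i j
  simp only [Matrix.add_apply, Matrix.smul_apply, proj_apply, Pi.smul_apply, Pi.star_apply]
  fin_cases i <;> fin_cases j <;> simp [Complex.ext_iff] <;> (try constructor) <;> grind

set_option maxHeartbeats 1000000 in
theorem outcomeProb_R {β : ℝ} (h0 : 1 / 3 ≤ β) (h1 : β ≤ 1 / 2) (b b' : Key) :
    outcomeProb (R β b) (zeta β b') = if b = b' then 0 else 1 / 3 := by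
  have hs : √(1 - 3 / 2 * β) ^ 2 = 1 - 3 / 2 * β := Real.sq_sqrt (by linarith)
  have ht : √(β / 2) ^ 2 = β / 2 := Real.sq_sqrt (by linarith)
  have h3 : √3 ^ 2 = 3 := Real.sq_sqrt (by norm_num)
  have h30 : √3 ≠ 0 := (Real.sqrt_pos.2 (by norm_num)).ne'
  have hb0 : β ≠ 0 := by linarith
  rw [R, symm_eq_diagonal, R00_eq h0 h1 rfl rfl rfl, zeta_eq_blochMatrix (by linarith) h1]
  obtain ⟨u, hu⟩ : ∃ u, u = √(1 - 3 / 2 * β) * √(β / 2) / (2 * √3 * β) := ⟨_, rfl⟩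
  obtain ⟨p, hp⟩ : ∃ p, p = (1 - 2 * β) / (4 * β) := ⟨_, rfl⟩
  obtain ⟨q, hq⟩ : ∃ q, q = √3 * (3 * β - 1) / (12 * β) := ⟨_, rfl⟩
  rw [← hu, ← hp, ← hq]
  generalize √(1 - 3 / 2 * β) = s at *
  generalize √(β / 2) = t at *
  -- Here `√3 * 3⁻¹` is the Bloch coordinate `1/√3`. The traces involve `u` and `q` only through
  -- these two products; `p` cancels by the antisymmetry of `[v]ₓ`.
  have e1 : s * t * u * (√3 * 3⁻¹) = (1 - 3 / 2 * β) / 12 := by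
    rw [hu, ← hs]; field_simp; rw [ht]; ring
  have e2 : t ^ 2 * q * (√3 * 3⁻¹) = (3 * β - 1) / 24 := by
    rw [hq, ht]; field_simp; rw [h3]; ring
  obtain ⟨i, j⟩ := b
  obtain ⟨i', j'⟩ := b'
  clear * - e1 e2 hs ht
  fin_cases i <;> fin_cases j <;> fin_cases i' <;> fin_cases j' <;>
    simp [outcomeProb, Matrix.trace, Matrix.mul_apply, Fin.sum_univ_succ, Matrix.diagonal, sign,
      blochMatrix, bloch, div_eq_mul_inv, ← Complex.ofReal_pow] <;> linarith

theorem R_isPOVM {β : ℝ} (h0 : 1 / 3 ≤ β) (h1 : β ≤ 1 / 2) : IsPOVM (R β) := by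
  refine ⟨R_posSemidef h0 h1, ?_⟩
  ext i j
  simp only [R, symm_eq_diagonal, R00_eq h0 h1 rfl rfl rfl, Fintype.sum_prod_type,
    Fin.sum_univ_two, Matrix.add_apply, Matrix.diagonal_mul, Matrix.mul_diagonal]
  -- The sign patterns are orthogonal characters of the key group, so the sum keeps only the
  -- diagonal of `R00 β`, which is `1/4`, four times.
  fin_cases i <;> fin_cases j <;> simp [sign] <;> norm_num <;> ring

theorem entropyGiven_R {β : ℝ} (h0 : 1 / 3 ≤ β) (h1 : β ≤ 1 / 2) :
    entropyGiven (R β) (zeta β) = Real.logb 2 3 := by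
  simp only [entropyGiven, shannon, outcomeProb_R h0 h1, Fintype.sum_prod_type, Fin.sum_univ_two]
  norm_num
  ring

end EightState

theorem mainTheorem11 (β : ℝ) (hβ₁ : 1 / 3 ≤ β) (hβ₂ : β ≤ 1 / 2) :
    EightState.IsPOVM (EightState.R β) ∧
    EightState.entropyGiven (EightState.R β) (EightState.zeta β) = Real.logb 2 3 ∧
    ∀ (ι : Type*) [Fintype ι] (M : ι → Matrix (Fin 4) (Fin 4) ℂ), EightState.IsPOVM M →
      EightState.entropyGiven (EightState.R β) (EightState.zeta β) ≤
        EightState.entropyGiven M (EightState.zeta β) := by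
  have h1 := EightState.entropyGiven_R hβ₁ hβ₂
  refine ⟨EightState.R_isPOVM hβ₁ hβ₂, h1, fun ι _ M hM => ?_⟩
  rw [h1]
  exact EightState.logb_three_le_entropyGiven (by linarith) hβ₂ hM
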